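/- **Setting.** Let $\langle\cdot,\cdot\rangle$ be the Euclidean scalar product. For a set $A\subset\mathbb R^k$ let $\Delta^*(z\mid A)=\sup_{\lambda\in A}\langle\lambda,z\rangle$ be its support function, and for $g:\mathbb R^k\to[-\infty,\infty]$ let $g^*(z)=\sup_\lambda\{\langle\lambda,z\rangle-g(\lambda)\}$, $\operatorname{dom} g=\{g<\infty\}$ and $\partial g(x)=\{v:\ g(y)\ge g(x)+\langle v,y-x\rangle\ \forall y\}$. For a convex set $C$ and $a\in C$ let $N_C(a)=\{v:\ \langle v,x-a\rangle\le 0\ \forall x\in C\}$. The relative interior is denoted by $\mathrm{ri}$. **Assumptions.** Let $(Z_i)_{i\ge1}$ be i.i.d. $\mathbb R^d$-valued random variables with $\mathbb E\,e^{\alpha|Z_1|}<\infty$ for some $\alpha>0$. Put $\Lambda(\theta)=\log\mathbb E\,e^{\langle\theta,Z_1\rangle}$ and $\mathcal D_Z=\{\theta\in\mathbb R^d:\Lambda(\theta)<\infty\}$. Assume that $Z_1/n$ satisfies the large deviation principle (at speed $n$) with a good rate function $I$, and that $I(z)=\Delta^*(z\mid\mathcal D_Z)$ for all $z$. Let $(\mathcal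 X,\rho)$ be a locally compact metric space, $(x_i^n)_{1\le i\le n,\,n\ge1}$ a triangular array in $\mathcal X$, and $R$ a Borel probability measure on $\mathcal X$ with compact support $\mathcal Y$ (so that $R(\mathcal Y)=1$ and $R(U)>0$ for every non-empty relatively open $U\subset\mathcal Y$), such that $\frac1n\sum_{i=1}^n\delta_{x_i^n}\to R$ weakly. Let $\mathcal B_n\subset\{1,\dots,n\}$ be index sets such that $\frac{\mathrm{card}(\mathcal B_n)}n\to1$, $\frac1{\mathrm{card}(\mathcal B_n)}\sum_{i\in\mathcal B_n}\delta_{x_i^n}\to R$ weakly, and $\max_{i\in\mathcal B_n}\rho(x_i^n,\mathcal Y)\to0$. Let $\mathbf f:\mathcal X\to\mathbb R^{m\times d}$ be continuous, with rows $f_1,\dots,f_m$, and put $C_n^{\mathbf f}=\{\mathbf f(x_i^n):\ i\notin\mathcal B_n\}$. Assume that the sets $C_n^{\mathbf f}$, $n\ge1$, are non-empty and contained in one compact set. Let $C^{\mathbf f}_{\infty,\mathrm{in}}$ be the set of limits of sequences $\mathbf y_n$ with $\mathbf y_n\in C_n^{\mathbf f}$ for all large $n$, and $C^{\mathbf f}_{\infty,\mathrm{out}}$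 the set of limits of sequences $\mathbf y_{\phi(n)}\in C^{\mathbf f}_{\phi(n)}$ along a strictly increasing $\phi$. For a matrix $\mathbf y$ let $\mathcal D_{\mathbf y}=\{\lambda\in\mathbb R^m:\ \log\mathbb E\,e^{\langle\lambda,\mathbf y\cdot Z_1\rangle}<\infty\}$, and assume $$\bigcap_{\mathbf y\in C^{\mathbf f}_{\infty,\mathrm{in}}}\mathcal D_{\mathbf y}=\bigcap_{\mathbf y\in C^{\mathbf f}_{\infty,\mathrm{out}}}\mathcal D_{\mathbf y}=:\mathcal D .$$ Put $\Gamma(\lambda)=\int_{\mathcal X}\Lambda\big(\sum_{k=1}^m\lambda_kf_k(x)\big)R(dx)$ for $\lambda\in\mathbb R^m$. The rate function $I_{\mathbf f}$ of the weighted means $L_n=\frac1n\sum_{i=1}^n\mathbf f(x_i^n)\cdot Z_i$ is the inf-convolution $$I_{\mathbf f}(z)=\inf\{\Gamma^*(z_1)+\Delta^*(z_2\mid\mathcal D):\ z_1+z_2=z\},\qquad z\in\mathbb R^m .$$ **Theorem 3.5.** Under these assumptions, for every $z\in\mathbb R^m$, $$I_{\mathbf f}(z)=\sup_{\lambda\in\mathcal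 D}\big(\langle\lambda,z\rangle-\Gamma(\lambda)\big).$$ Moreover, for every $z\in\mathrm{ri}\,\mathrm{dom}\,I_{\mathbf f}$ there are $\lambda^*\in\mathrm{dom}\,\Gamma\cap\bar{\mathcal D}$, $z^*\in\partial\Gamma(\lambda^*)$ and $z_{\mathbf n}\in N_{\bar{\mathcal D}}(\lambda^*)$ with $z=z^*+z_{\mathbf n}$; and for every such decomposition, $$I_{\mathbf f}(z)=\Gamma^*(z^*)+\Delta^*(z_{\mathbf n}\mid\mathcal D).$$ -/

import Mathlib

open MeasureTheory ProbabilityTheory Filter Topology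
open scoped ENNReal BoundedContinuousFunction

noncomputable section

namespace WeightedMeanLDP

/-- `ℝ^k` with its Euclidean structure. -/
abbrev Vec (k : ℕ) : Type := EuclideanSpace ℝ (Fin k)

/-! ### Extended-real integrals -/

/-- The integral of an extended-real function, `∫ g⁺ dμ - ∫ g⁻ dμ`. -/
def extIntegral {S : Type*} [MeasurableSpace S] (μ : Measure S) (g : S → EReal) : EReal :=
  ((∫⁻ s, (g s).toENNReal ∂μ : ℝ≥0∞) : EReal) - ((∫⁻ s, (-(g s)).toENNReal ∂μ : ℝ≥0∞) : EReal)

/-! ### Convex analysis in `ℝ^k` -/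

section ConvexAnalysis

variable {k : ℕ}

/-- The effective domain of an extended-real function. -/
def effDom (g : Vec k → EReal) : Set (Vec k) := {z | g z < ⊤}

/-- The convex conjugate `g*(z) = sup_l (⟨l, z⟩ - g l)`. -/
def conjugate (g : Vec k → EReal) (z : Vec k) : EReal :=
  ⨆ l : Vec k, ((inner ℝ l z : ℝ) : EReal) - g l

/-- The support function `Δ*(z | A) = sup_{l ∈ A} ⟨z, l⟩`. -/
def supportFun (A : Set (Vec k)) (z : Vec k) : EReal :=
  ⨆ l ∈ A, ((inner ℝ z l : ℝ) : EReal)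

/-- The inf-convolution `inf {g z₁ + h z₂ : z₁ + z₂ = z}`. -/
def infConv (g h : Vec k → EReal) (z : Vec k) : EReal :=
  ⨅ (z₁ : Vec k) (z₂ : Vec k) (_ : z₁ + z₂ = z), g z₁ + h z₂

/-- The normal cone of `C` at a point `a` (of `C`). -/
def normalCone (C : Set (Vec k)) (a : Vec k) : Set (Vec k) :=
  {v | ∀ x ∈ C, inner ℝ v (x - a) ≤ (0 : ℝ)}

/-- The subdifferential of an extended-real function at `x`. -/
def subdifferential (g : Vec k → EReal) (x : Vec k) : Set (Vec k) :=
  {v | ∀ y : Vec k, g x + ((inner ℝ v (y - x) : ℝ) : EReal) ≤ g y}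

end ConvexAnalysis

/-! ### Large deviations, at speed `n` -/

section LargeDeviations

variable {k : ℕ}

/-- A good rate function: values in `[0, ∞]` and compact level sets
(in particular it is lower semicontinuous). -/
def IsGoodRateFunction (I : Vec k → EReal) : Prop :=
  (∀ z, 0 ≤ I z) ∧ ∀ a : ℝ, IsCompact {z | I z ≤ (a : EReal)}

/-- The large deviation principle (at speed `n`) for the sequence of laws `μ n`
with rate function `I`. -/
def SatisfiesLDP (μ : ℕ → Measure (Vec k)) (I : Vec k → EReal) : Prop :=
  (∀ F : Set (Vec k), IsClosed F →
    limsup (fun n : ℕ => (((n : ℝ)⁻¹ : ℝ) : EReal) * ENNReal.log (μ n F)) atTop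
      ≤ -(⨅ z ∈ F, I z)) ∧
  (∀ G : Set (Vec k), IsOpen G →
    -(⨅ z ∈ G, I z)
      ≤ liminf (fun n : ℕ => (((n : ℝ)⁻¹ : ℝ) : EReal) * ENNReal.log (μ n G)) atTop)

end LargeDeviations

/-! ### Limits of sets in the sense of Painlevé and Kuratowski -/

section SetLimits

variable {S : Type*} [TopologicalSpace S]

/-- The inner limit of a sequence of sets. -/
def innerLimit (D : ℕ → Set S) : Set S :=
  {s | ∃ n₀ : ℕ, ∃ u : ℕ → S, (∀ n ≥ n₀, u n ∈ D n) ∧ Tendsto u atTop (𝓝 s)}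

/-- The outer limit of a sequence of sets. -/
def outerLimit (D : ℕ → Set S) : Set S :=
  {s | ∃ φ : ℕ → ℕ, StrictMono φ ∧ ∃ u : ℕ → S,
    (∀ n, u n ∈ D (φ n)) ∧ Tendsto u atTop (𝓝 s)}

end SetLimits

/-! ### Empirical measures and weak convergence -/

section Empirical

variable {X : Type*} [MeasurableSpace X]

/-- The empirical measure `(1 / card S) ∑_{i ∈ S} δ_{x i}`. -/
def empiricalMeasure {n : ℕ} (S : Finset (Fin n)) (x : Fin n → X) : Measure X :=
  (S.card : ℝ≥0∞)⁻¹ • ∑ i ∈ S, Measure.dirac (x i)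

/-- Weak convergence, tested against bounded continuous functions. -/
def ConvergesWeakly [TopologicalSpace X] (μ : ℕ → Measure X) (ν : Measure X) : Prop :=
  ∀ g : X →ᵇ ℝ, Tendsto (fun n => ∫ s, g s ∂(μ n)) atTop (𝓝 (∫ s, g s ∂ν))

end Empirical

/-! ### The log-Laplace transform and the objects derived from it -/

section Laplace

variable {Ω : Type*} [MeasurableSpace Ω] {d m : ℕ}

/-- The log-Laplace transform `Λ(θ) = log E exp ⟨θ, Z⟩`, with values in `[-∞, ∞]`. -/
def logLaplace {k : ℕ} (P : Measure Ω) (Z : Ω → Vec k) (θ : Vec k) : EReal :=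
  ENNReal.log (∫⁻ ω, ENNReal.ofReal (Real.exp (inner ℝ θ (Z ω))) ∂P)

/-- The product of a matrix with a vector. -/
def matVec (y : Matrix (Fin m) (Fin d) ℝ) (v : Vec d) : Vec m :=
  WithLp.toLp 2 (y.mulVec v.ofLp)

/-- `D_Z = {θ : log E exp ⟨θ, Z⟩ < ∞}`. -/
def laplaceDomain (P : Measure Ω) (Z : Ω → Vec d) : Set (Vec d) :=
  {θ | logLaplace P Z θ < ⊤}

/-- `D_y = {l : log E exp ⟨l, y · Z⟩ < ∞}`, for an `m × d` matrix `y`. -/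
def matrixDomain (P : Measure Ω) (Z : Ω → Vec d) (y : Matrix (Fin m) (Fin d) ℝ) :
    Set (Vec m) :=
  {l | logLaplace P (fun ω => matVec y (Z ω)) l < ⊤}

/-- `⋂_{y ∈ A} D_y`. -/
def commonDomain (P : Measure Ω) (Z : Ω → Vec d) (A : Set (Matrix (Fin m) (Fin d) ℝ)) :
    Set (Vec m) :=
  ⋂ y ∈ A, matrixDomain P Z y

/-- `Γ(l) = ∫ Λ(∑ k, l_k f_k(x)) R(dx)`, where `f_k` is the `k`-th row of `f`. -/
def gammaFun {X : Type*} [MeasurableSpace X] (P : Measure Ω) (Z : Ω → Vec d)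
    (R : Measure X) (f : X → Matrix (Fin m) (Fin d) ℝ) (l : Vec m) : EReal :=
  extIntegral R (fun x => logLaplace P Z (∑ k : Fin m, l k • (WithLp.toLp 2 (f x k) : Vec d)))

/-- The rate function of the weighted mean:
`I_f(z) = inf {Γ*(z₁) + Δ*(z₂ | D) : z₁ + z₂ = z}`. -/
def rateFun {X : Type*} [MeasurableSpace X] (P : Measure Ω) (Z : Ω → Vec d)
    (R : Measure X) (f : X → Matrix (Fin m) (Fin d) ℝ) (D : Set (Vec m)) : Vec m → EReal :=
  infConv (conjugate (gammaFun P Z R f)) (supportFun D)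

end Laplace

/-- The set `C_n^f` of the matrices `f (x i)`, for the indices `i` outside `B`. -/
def outlierMatrices {X : Type*} {m d n : ℕ} (f : X → Matrix (Fin m) (Fin d) ℝ)
    (x : Fin n → X) (B : Finset (Fin n)) : Set (Matrix (Fin m) (Fin d) ℝ) :=
  {y | ∃ i : Fin n, i ∉ B ∧ y = f (x i)}

end WeightedMeanLDP

end

open WeightedMeanLDP

/-! The rate function is the conjugate of `Γ` restricted to `D`, so everything is Fenchel duality
with `0 ∈ interior D` and `Γ 0 = 0` as the qualification condition. The probability only supplies
the hypotheses. The exponential moment and the compactness of the outlier weights make `D` a convex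
neighbourhood of `0`. Centering `Z` at its mean splits `Γ` into a convex, lower semicontinuous,
nonnegative part plus a linear form (`exists_gammaFun_eq`), so its epigraph is convex and closed and
`Γ` avoids `⊥`. A separating hyperplane then splits `z` exactly between `Γ*` and the support
function (`exists_split_of_zero_mem_interior`), which gives the formula. At a relative interior
point `z` of its domain, the rate function has a subgradient `l`. Closedness of the epigraph over
`closure D` makes `l` a maximizer of `⟨l, z⟩ - Γ l`
(`exists_mem_epigraph_of_mem_intrinsicInterior`), and the exact splitting at this maximizer is the
required decomposition. Conversely, any such decomposition attains the infimum by equality in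
Fenchel's inequality. -/

noncomputable section

namespace WeightedMeanLDP

/-! ### Subgradients and separation for real convex functions and epigraphs -/

section Convex

variable {E : Type*} [NormedAddCommGroup E]

theorem apply_prod_eq [NormedSpace ℝ E] (F : StrongDual ℝ (E × ℝ)) (v : E) (t : ℝ) :
    F (v, t) = F.comp (ContinuousLinearMap.inl ℝ E ℝ) v + F (0, 1) * t := by
  have : ((v, t) : E × ℝ) = (v, 0) + t • ((0 : E), (1 : ℝ)) := by simp
  rw [this, map_add, map_smul]
  simp [mul_comm]

/-- A convex function has a subgradient at every interior point of its domain. -/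
theorem exists_subgradient_of_mem_interior [NormedSpace ℝ E] [FiniteDimensional ℝ E]
    {C : Set E} {φ : E → ℝ}
    (hφ : ConvexOn ℝ C φ) {x : E} (hx : x ∈ interior C) :
    ∃ p : StrongDual ℝ E, ∀ y ∈ C, φ x + p (y - x) ≤ φ y := by
  have hφi : ConvexOn ℝ (interior C) φ := hφ.subset interior_subset hφ.1.interior
  have hopen : IsOpen {q : E × ℝ | q.1 ∈ interior C ∧ φ q.1 < q.2} := by
    have hc : ContinuousOn (fun q : E × ℝ => q.2 - φ q.1) (Prod.fst ⁻¹' interior C) :=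
      continuous_snd.continuousOn.sub
        (hφ.continuousOn_interior.comp continuous_fst.continuousOn fun _ h => h)
    convert hc.isOpen_inter_preimage (isOpen_interior.preimage continuous_fst) isOpen_Ioi (t := Set.Ioi 0)
      using 1
    ext q
    simp
  -- The strict epigraph over the interior is open because a convex function is continuous there. A
  -- supporting functional at `(x, φ x)` has negative vertical slope `c`, and dividing by `-c` gives
  -- the subgradient.
  obtain ⟨F, hF⟩ := geometric_hahn_banach_open_point (x := (x, φ x)) hφi.convex_strict_epigraph
    hopen (by simp)
  set c := F (0, 1)
  set G := F.comp (ContinuousLinearMap.inl ℝ E ℝ)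
  have hF' : ∀ v ∈ interior C, ∀ t, φ v < t → G v + c * t < G x + c * φ x := fun v hv t ht => by
    have := hF (v, t) ⟨hv, ht⟩
    rwa [apply_prod_eq, apply_prod_eq F x] at this
  have hc : c < 0 := by
    have := hF' x hx (φ x + 1) (by linarith)
    linarith
  have key : ∀ v ∈ interior C, φ x + (-c⁻¹ • G) (v - x) ≤ φ v := fun v hv => by
    refine le_of_forall_gt fun t ht => ?_
    have := hF' v hv t ht
    have h2 : (-c⁻¹ • G) (v - x) = -c⁻¹ * (G v - G x) := by
      simp only [map_sub, smul_apply, smul_eq_mul]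
      ring
    rw [h2]
    have h3 : c * (φ x + -c⁻¹ * (G v - G x)) = c * φ x - (G v - G x) := by
      have := hc.ne
      field_simp
      ring
    have h4 : c * t < c * (φ x + -c⁻¹ * (G v - G x)) := by rw [h3]; linarith
    exact lt_of_mul_lt_mul_of_nonpos_left h4 hc.le
  refine ⟨-c⁻¹ • G, fun y hy => ?_⟩
  -- For `y` on the boundary: the midpoint of `x` and `y` is interior, and convexity carries the
  -- inequality from the midpoint to `y`.
  have hm := hφ.1.combo_interior_self_mem_interior hx hy (a := 1 / 2) (b := 1 / 2)
    (by norm_num) (by norm_num) (by norm_num)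
  have h1 := key _ hm
  have h2 := hφ.2 (interior_subset hx) hy (by norm_num : (0 : ℝ) ≤ 1 / 2)
    (by norm_num : (0 : ℝ) ≤ 1 / 2) (by norm_num)
  have h3 : (1 / 2 : ℝ) • x + (1 / 2 : ℝ) • y - x = (1 / 2 : ℝ) • (y - x) := by module
  rw [h3, map_smul] at h1
  simp only [smul_eq_mul] at h1 h2
  linarith

variable [InnerProductSpace ℝ E]

/-- A convex function has a subgradient at every point of the relative interior of its domain. -/
theorem exists_subgradient_of_mem_intrinsicInterior [FiniteDimensional ℝ E] {K : Set E} {φ : E → ℝ}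
    (hφ : ConvexOn ℝ K φ) {z : E} (hz : z ∈ intrinsicInterior ℝ K) :
    ∃ p : E, ∀ w ∈ K, φ z + inner ℝ p (w - z) ≤ φ w := by
  obtain ⟨y, hy, rfl⟩ := mem_intrinsicInterior.1 hz
  set V := (affineSpan ℝ K).direction
  have hι : Continuous fun v : V => (⟨(v : E) + y, AffineSubspace.vadd_mem_of_mem_direction v.2 y.2⟩ :
      affineSpan ℝ K) :=
    (continuous_subtype_val.add continuous_const).subtype_mk _
  -- Translated to the direction space of the affine span, the relative interior becomes an ordinary
  -- interior at `0`.
  have hconv := (hφ.translate_right (y : E)).comp_linearMap V.subtype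
  obtain ⟨q, hq⟩ := exists_subgradient_of_mem_interior (x := 0) hconv <| by
    refine interior_mono ?_ (preimage_interior_subset_interior_preimage hι
      (t := (↑) ⁻¹' K) (a := 0) (by simpa using hy))
    intro v hv
    simpa [add_comm] using hv
  refine ⟨((InnerProductSpace.toDual ℝ V).symm q : V), fun w hw => ?_⟩
  have hwV : w - y ∈ V := AffineSubspace.vsub_mem_direction (subset_affineSpan ℝ K hw) y.2
  have := hq ⟨w - y, hwV⟩ (by simpa using hw)
  have h2 : inner ℝ (((InnerProductSpace.toDual ℝ V).symm q : V) : E) (w - y)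
      = q ⟨w - y, hwV⟩ := by
    rw [← InnerProductSpace.toDual_symm_apply, Submodule.coe_inner]
  rw [h2]
  simpa using this

/-- A supremum of affine functions is convex. Restricting to the points where the family is bounded
keeps the real-valued supremum meaningful. -/
theorem convexOn_iSup_inner_sub (S : Set (E × ℝ)) [Nonempty S] :
    ConvexOn ℝ {w : E | BddAbove (Set.range fun q : S => inner ℝ q.1.1 w - q.1.2)}
      fun w => ⨆ q : S, (inner ℝ q.1.1 w - q.1.2) := by
  have key : ∀ w w' : E, BddAbove (Set.range fun q : S => inner ℝ q.1.1 w - q.1.2) →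
      BddAbove (Set.range fun q : S => inner ℝ q.1.1 w' - q.1.2) →
      ∀ a b : ℝ, 0 ≤ a → 0 ≤ b → a + b = 1 → ∀ q : S,
      inner ℝ q.1.1 (a • w + b • w') - q.1.2 ≤
        a * (⨆ q : S, (inner ℝ q.1.1 w - q.1.2)) + b * ⨆ q : S, (inner ℝ q.1.1 w' - q.1.2) := by
    intro w w' hw hw' a b ha hb hab q
    have h1 := mul_le_mul_of_nonneg_left (le_ciSup hw q) ha
    have h2 := mul_le_mul_of_nonneg_left (le_ciSup hw' q) hb
    rw [inner_add_right, real_inner_smul_right, real_inner_smul_right]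
    have : q.1.2 = a * q.1.2 + b * q.1.2 := by rw [← add_mul, hab, one_mul]
    linarith
  refine ⟨fun w hw w' hw' a b ha hb hab =>
    ⟨a * (⨆ q : S, (inner ℝ q.1.1 w - q.1.2)) + b * ⨆ q : S, (inner ℝ q.1.1 w' - q.1.2), ?_⟩, fun w hw w' hw' a b ha hb hab => ?_⟩
  · rintro _ ⟨q, rfl⟩
    exact key w w' hw hw' a b ha hb hab q
  · exact ciSup_le fun q => key w w' hw hw' a b ha hb hab q

/-- The conjugate of a closed convex function, given by its epigraph `S`, is attained at the
points of the relative interior of its domain. -/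
theorem exists_mem_epigraph_of_mem_intrinsicInterior [FiniteDimensional ℝ E] {S : Set (E × ℝ)} (hS : Convex ℝ S)
    (hcl : IsClosed S) (hne : S.Nonempty)
    (hup : ∀ q ∈ S, ∀ t, q.2 ≤ t → (q.1, t) ∈ S) {z : E}
    (hz : z ∈ intrinsicInterior ℝ
      {w : E | BddAbove (Set.range fun q : S => inner ℝ q.1.1 w - q.1.2)}) :
    ∃ l : E, (l, inner ℝ l z - ⨆ q : S, (inner ℝ q.1.1 z - q.1.2)) ∈ S := by
  have := hne.to_subtype
  obtain ⟨p, hp⟩ := exists_subgradient_of_mem_intrinsicInterior (convexOn_iSup_inner_sub S) hz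
  have hzK := intrinsicInterior_subset hz
  set φ : E → ℝ := fun w => ⨆ q : S, (inner ℝ q.1.1 w - q.1.2)
  -- The subgradient `p` is itself the maximizer: otherwise a hyperplane strictly separates its
  -- point from the closed set `S`, and the subgradient inequality fails at a suitable test point.
  refine ⟨p, by_contra fun hnot => ?_⟩
  obtain ⟨F, u, hFu, huF⟩ := geometric_hahn_banach_point_closed hS hcl hnot
  set c := F (0, 1)
  set w := (InnerProductSpace.toDual ℝ E).symm (F.comp (ContinuousLinearMap.inl ℝ E ℝ)) with hw
  have hF : ∀ v t, F (v, t) = inner ℝ v w + c * t := fun v t => by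
    rw [apply_prod_eq, real_inner_comm, hw, InnerProductSpace.toDual_symm_apply]
  rw [hF] at hFu
  have huS : ∀ q ∈ S, u < inner ℝ q.1 w + c * q.2 := fun q hq => by
    rw [← hF]; exact huF q hq
  have hbound : ∀ w' : E, ∀ M : ℝ, (∀ q ∈ S, inner ℝ q.1 w' - q.2 ≤ M) →
      φ z + inner ℝ p (w' - z) ≤ M := fun w' M hM =>
    (hp w' ⟨M, by rintro _ ⟨q, rfl⟩; exact hM q q.2⟩).trans (ciSup_le fun q => hM q q.2)
  obtain ⟨q₀, hq₀⟩ := hne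
  -- `S` is unbounded upwards, so a negative vertical slope would break the lower bound `u`.
  have hc : 0 ≤ c := by
    by_contra! hc
    have h1 := huS q₀ hq₀
    have h2 := huS _ (hup q₀ hq₀ (q₀.2 + (inner ℝ q₀.1 w + c * q₀.2 - u) / (-c)) (by
      have := div_pos (sub_pos.2 h1) (neg_pos.2 hc)
      linarith))
    have h3 : c * ((inner ℝ q₀.1 w + c * q₀.2 - u) / (-c)) = -(inner ℝ q₀.1 w + c * q₀.2 - u) := by
      have := hc.ne
      field_simp
    simp only [mul_add] at h2
    linarith
  -- A vertical hyperplane is refuted at `z - w`, a non-vertical one at its own slope `-(c⁻¹ • w)`.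
  rcases hc.eq_or_lt with hc | hc
  · have := hbound (z - w) (φ z - u) fun q hq => by
      have h1 := huS q hq
      have h2 := le_ciSup hzK ⟨q, hq⟩
      rw [← hc] at h1
      simp only [inner_sub_right] at *
      change _ ≤ φ z at h2
      linarith
    rw [← hc] at hFu
    rw [inner_sub_right, inner_sub_right] at this
    linarith
  · have := hbound (-(c⁻¹ • w)) (-(c⁻¹ * u)) fun q hq => by
      have h1 := mul_lt_mul_of_pos_left (huS q hq) (inv_pos.2 hc)
      rw [inner_neg_right, real_inner_smul_right]
      rw [mul_add, ← mul_assoc, inv_mul_cancel₀ hc.ne', one_mul] at h1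
      linarith
    rw [inner_sub_right, inner_neg_right, real_inner_smul_right] at this
    have h1 := mul_lt_mul_of_pos_left hFu (inv_pos.2 hc)
    rw [mul_add, ← mul_assoc, inv_mul_cancel₀ hc.ne', one_mul] at h1
    change _ + (_ - φ z) < _ at h1
    linarith

/-- The conjugate of the restriction of a convex function (given by its epigraph `S`) to a convex
neighbourhood `D` of `0` is an exact inf-convolution. -/
theorem exists_split_of_zero_mem_interior [FiniteDimensional ℝ E] {S : Set (E × ℝ)} (hS : Convex ℝ S)
    (h0 : ((0 : E), (0 : ℝ)) ∈ S) {D : Set E} (hD : Convex ℝ D) (hD0 : 0 ∈ interior D)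
    {z : E} {s : ℝ} (hs : ∀ q ∈ S, q.1 ∈ D → inner ℝ q.1 z - q.2 ≤ s) :
    ∃ (z₁ z₂ : E) (a b : ℝ), z₁ + z₂ = z ∧ a + b = s ∧
      (∀ q ∈ S, inner ℝ q.1 z₁ - q.2 ≤ a) ∧ ∀ l ∈ closure D, inner ℝ l z₂ ≤ b := by
  -- The hypothesis `hs` says that `S` lies above the affine function `⟨·, z⟩ - s` over `D`. Its
  -- strict hypograph over `interior D` is an open convex set disjoint from `S`.
  set A : Set (E × ℝ) := {q | q.1 ∈ interior D ∧ q.2 < inner ℝ q.1 z - s}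
  have hAopen : IsOpen A :=
    (isOpen_interior.preimage continuous_fst).inter
      (isOpen_lt continuous_snd (by fun_prop))
  have hAconv : Convex ℝ A := by
    rintro ⟨v, t⟩ ⟨hv, ht⟩ ⟨v', t'⟩ ⟨hv', ht'⟩ a b ha hb hab
    refine ⟨hD.interior hv hv' ha hb hab, ?_⟩
    simp only [Prod.snd_add, Prod.smul_snd, Prod.fst_add, Prod.smul_fst, smul_eq_mul,
      inner_add_left, real_inner_smul_left] at *
    have : s = a * s + b * s := by rw [← add_mul, hab, one_mul]
    rcases ha.eq_or_lt with rfl | ha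
    · have : b = 1 := by linarith
      subst this
      linarith
    · have h1 := mul_lt_mul_of_pos_left ht ha
      have h2 := mul_le_mul_of_nonneg_left ht'.le hb
      linarith
  have hdisj : Disjoint A S := by
    rw [Set.disjoint_left]
    rintro q ⟨hq1, hq2⟩ hqS
    have := hs q hqS (interior_subset hq1)
    linarith
  obtain ⟨F, u, hFA, hFS⟩ := geometric_hahn_banach_open hAconv hAopen hS hdisj
  set c := F (0, 1)
  set w := (InnerProductSpace.toDual ℝ E).symm (F.comp (ContinuousLinearMap.inl ℝ E ℝ)) with hw
  have hF : ∀ v t, F (v, t) = inner ℝ v w + c * t := fun v t => by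
    rw [apply_prod_eq, real_inner_comm, hw, InnerProductSpace.toDual_symm_apply]
  have hu0 : u ≤ 0 := by simpa [hF] using hFS _ h0
  have hFA' : ∀ v ∈ interior D, ∀ t, t < inner ℝ v z - s → inner ℝ v w + c * t < u :=
    fun v hv t ht => by rw [← hF]; exact hFA (v, t) ⟨hv, ht⟩
  have hs0 : 0 ≤ s := by simpa using hs _ h0 (interior_subset hD0)
  -- The qualification condition enters here: points of `A` below the origin, with the origin in
  -- `S`, exclude a vertical hyperplane.
  have hc : 0 < c := by
    have := hFA' 0 hD0 (-s - 1) (by simp)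
    rw [inner_zero_left, zero_add] at this
    by_contra! hc
    nlinarith
  -- The separating hyperplane is the graph of `l ↦ ⟨l, z₁⟩ - a`. It lies below `S`, which bounds
  -- the first part, and above `A`, which bounds the remainder `⟨l, z - z₁⟩` by `s - a`.
  refine ⟨-(c⁻¹ • w), z + c⁻¹ • w, -(c⁻¹ * u), s + c⁻¹ * u, by abel, by ring, fun q hq => ?_,
    fun l hl => ?_⟩
  · have h1 := mul_le_mul_of_nonneg_left (hFS q hq) (inv_pos.2 hc).le
    rw [show F q = _ from hF q.1 q.2, mul_add, ← mul_assoc, inv_mul_cancel₀ hc.ne', one_mul] at h1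
    rw [inner_neg_right, real_inner_smul_right]
    linarith
  · rw [← hD.closure_interior_eq_closure_of_nonempty_interior ⟨0, hD0⟩] at hl
    refine closure_minimal (t := {l : E | inner ℝ l (z + c⁻¹ • w) ≤ s + c⁻¹ * u}) ?_
      (isClosed_le (by fun_prop) continuous_const) hl
    intro v hv
    rw [Set.mem_ofPred_eq, inner_add_right, real_inner_smul_right]
    have : inner ℝ v z - s ≤ c⁻¹ * (u - inner ℝ v w) := by
      refine le_of_forall_lt fun t ht => ?_
      have h1 := mul_lt_mul_of_pos_left (hFA' v hv t ht) (inv_pos.2 hc)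
      rw [mul_add, ← mul_assoc, inv_mul_cancel₀ hc.ne', one_mul] at h1
      linarith
    linarith

end Convex

/-! ### Fenchel duality for extended-real functions -/

section Duality

variable {k : ℕ} {g : Vec k → EReal} {D : Set (Vec k)}

/-- Replaces extended-real arithmetic by real inequalities over the epigraph, the form in which the
separation results apply. -/
theorem conjugate_le_coe_iff (hbot : ∀ l, g l ≠ ⊥) {z : Vec k} {a : ℝ} :
    conjugate g z ≤ a ↔ ∀ q : Vec k × ℝ, g q.1 ≤ q.2 → inner ℝ q.1 z - q.2 ≤ a := by
  rw [conjugate, iSup_le_iff]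
  constructor
  · rintro h ⟨l, t⟩ hlt
    have h1 : ((inner ℝ l z : ℝ) : EReal) - t ≤ a :=
      (EReal.sub_le_sub le_rfl hlt).trans (h l)
    exact_mod_cast h1
  · intro h l
    induction hg : g l with
    | bot => exact absurd hg (hbot l)
    | top => simp
    | coe t => exact_mod_cast h (l, t) hg.le

theorem supportFun_le_coe_iff {z : Vec k} {b : ℝ} :
    supportFun D z ≤ b ↔ ∀ l ∈ D, inner ℝ l z ≤ b := by
  simp only [supportFun, iSup_le_iff, EReal.coe_le_coe_iff]
  simp only [real_inner_comm z]

/-- A bound for the conjugate of a convex function restricted to a convex neighbourhood of `0`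
extends to the closure of this neighbourhood. -/
theorem inner_sub_le_of_mem_closure (hg : Convex ℝ {q : Vec k × ℝ | g q.1 ≤ q.2}) (h0 : g 0 = 0)
    (hD : Convex ℝ D) (hD0 : 0 ∈ interior D) {z : Vec k} {s : ℝ}
    (hs : ∀ q : Vec k × ℝ, g q.1 ≤ q.2 → q.1 ∈ D → inner ℝ q.1 z - q.2 ≤ s)
    {q : Vec k × ℝ} (hq : g q.1 ≤ q.2) (hqD : q.1 ∈ closure D) : inner ℝ q.1 z - q.2 ≤ s := by
  -- Shrinking towards the origin stays in the epigraph by convexity and moves a point of `closure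
  -- D` into `D`; then `t → 1`.
  have key : ∀ t ∈ Set.Ioo (0 : ℝ) 1, t * (inner ℝ q.1 z - q.2) ≤ s := fun t ht => by
    have h1 : t • q ∈ {q : Vec k × ℝ | g q.1 ≤ q.2} := by
      have := hg hq (show ((0 : Vec k), (0 : ℝ)) ∈ {q : Vec k × ℝ | g q.1 ≤ q.2} by simp [h0])
        ht.1.le (sub_nonneg.2 ht.2.le) (by ring)
      rwa [show ((0 : Vec k), (0 : ℝ)) = 0 from rfl, smul_zero, add_zero] at this
    have h2 : t • q.1 ∈ D := by
      have := hD.combo_closure_interior_mem_interior hqD hD0 ht.1.le (sub_pos.2 ht.2) (by ring)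
      rw [smul_zero, add_zero] at this
      exact interior_subset this
    have h3 := hs (t • q) h1 h2
    rw [Prod.smul_fst, Prod.smul_snd, real_inner_smul_left, smul_eq_mul] at h3
    linarith
  have hlim : Tendsto (fun t : ℝ => t * (inner ℝ q.1 z - q.2)) (𝓝[<] 1)
      (𝓝 (1 * (inner ℝ q.1 z - q.2))) :=
    ((continuous_id.mul continuous_const).tendsto 1).mono_left nhdsWithin_le_nhds
  rw [one_mul] at hlim
  exact le_of_tendsto hlim (by
    filter_upwards [Ioo_mem_nhdsLT (zero_lt_one (α := ℝ))] with t ht using key t ht)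

/-- One direction is weak duality, the Fenchel inequality for each splitting of `z`; the other is
the exact splitting. -/
theorem infConv_le_coe_iff (hg : Convex ℝ {q : Vec k × ℝ | g q.1 ≤ q.2}) (h0 : g 0 = 0)
    (hbot : ∀ l, g l ≠ ⊥) (hD : Convex ℝ D) (hD0 : 0 ∈ interior D) {z : Vec k} {s : ℝ} :
    infConv (conjugate g) (supportFun D) z ≤ s ↔
      ∀ q : Vec k × ℝ, g q.1 ≤ q.2 → q.1 ∈ D → inner ℝ q.1 z - q.2 ≤ s := by
  constructor
  · rintro h ⟨l, t⟩ hlt hlD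
    suffices ((inner ℝ l z : ℝ) : EReal) - t ≤ infConv (conjugate g) (supportFun D) z by
      exact_mod_cast this.trans h
    refine le_iInf fun z₁ => le_iInf fun z₂ => le_iInf fun hz => ?_
    have h1 : ((inner ℝ l z₁ - t : ℝ) : EReal) ≤ conjugate g z₁ := by
      rw [EReal.coe_sub]
      exact (EReal.sub_le_sub le_rfl hlt).trans
        (le_iSup (fun l => ((inner ℝ l z₁ : ℝ) : EReal) - g l) l)
    have h2 : ((inner ℝ l z₂ : ℝ) : EReal) ≤ supportFun D z₂ := by
      rw [real_inner_comm]
      exact le_iSup₂ (f := fun l (_ : l ∈ D) => ((inner ℝ z₂ l : ℝ) : EReal)) l hlD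
    refine le_trans (le_of_eq ?_) (add_le_add h1 h2)
    rw [← hz, inner_add_right]
    norm_cast
    ring
  · intro h
    obtain ⟨z₁, z₂, a, b, hz, hab, ha, hb⟩ :=
      exists_split_of_zero_mem_interior hg (by simp [h0]) hD hD0 h
    refine (iInf₂_le_of_le z₁ z₂ (iInf_le_of_le hz le_rfl)).trans ?_
    rw [← hab, EReal.coe_add]
    exact add_le_add ((conjugate_le_coe_iff hbot).2 ha)
      (supportFun_le_coe_iff.2 fun l hl => hb l (subset_closure hl))

theorem infConv_conjugate_supportFun (hg : Convex ℝ {q : Vec k × ℝ | g q.1 ≤ q.2}) (h0 : g 0 = 0)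
    (hbot : ∀ l, g l ≠ ⊥) (hD : Convex ℝ D) (hD0 : 0 ∈ interior D) (z : Vec k) :
    infConv (conjugate g) (supportFun D) z = ⨆ l ∈ D, ((inner ℝ l z : ℝ) : EReal) - g l := by
  have key : ∀ s : ℝ, (⨆ l ∈ D, ((inner ℝ l z : ℝ) : EReal) - g l) ≤ s ↔
      infConv (conjugate g) (supportFun D) z ≤ s := fun s => by
    rw [infConv_le_coe_iff hg h0 hbot hD hD0, iSup₂_le_iff]
    constructor
    · rintro h ⟨l, t⟩ hlt hlD
      exact_mod_cast (EReal.sub_le_sub le_rfl hlt).trans (h l hlD)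
    · intro h l hlD
      induction hgl : g l with
      | bot => exact absurd hgl (hbot l)
      | top => simp
      | coe t => exact_mod_cast h (l, t) hgl.le hlD
  exact le_antisymm (EReal.le_of_forall_lt_iff_le.1 fun s hs => (key s).1 hs.le)
    (EReal.le_of_forall_lt_iff_le.1 fun s hs => (key s).2 hs.le)

/-- Passing to `closure D` does not change the domain but makes the truncated epigraph closed, as
attainment requires. -/
theorem effDom_infConv (hg : Convex ℝ {q : Vec k × ℝ | g q.1 ≤ q.2}) (h0 : g 0 = 0)
    (hbot : ∀ l, g l ≠ ⊥) (hD : Convex ℝ D) (hD0 : 0 ∈ interior D) :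
    effDom (infConv (conjugate g) (supportFun D)) = {w | BddAbove (Set.range
      fun q : {q : Vec k × ℝ | q.1 ∈ closure D ∧ g q.1 ≤ q.2} => inner ℝ q.1.1 w - q.1.2)} := by
  ext w
  constructor
  · intro hw
    obtain ⟨s, hs, -⟩ := EReal.lt_iff_exists_real_btwn.1 (show _ < _ from hw)
    refine ⟨s, ?_⟩
    rintro _ ⟨q, rfl⟩
    exact inner_sub_le_of_mem_closure hg h0 hD hD0
      ((infConv_le_coe_iff hg h0 hbot hD hD0).1 hs.le) q.2.2 q.2.1
  · rintro ⟨s, hs⟩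
    refine lt_of_le_of_lt ((infConv_le_coe_iff hg h0 hbot hD hD0 (s := s)).2 ?_)
      (EReal.coe_lt_top s)
    exact fun q hq hqD => hs ⟨⟨q, subset_closure hqD, hq⟩, rfl⟩

theorem exists_subdifferential_add_normalCone (hg : Convex ℝ {q : Vec k × ℝ | g q.1 ≤ q.2})
    (hcl : IsClosed {q : Vec k × ℝ | g q.1 ≤ q.2}) (h0 : g 0 = 0)
    (hbot : ∀ l, g l ≠ ⊥) (hD : Convex ℝ D) (hD0 : 0 ∈ interior D) {z : Vec k}
    (hz : z ∈ intrinsicInterior ℝ (effDom (infConv (conjugate g) (supportFun D)))) :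
    ∃ zs zn l : Vec k, z = zs + zn ∧ l ∈ effDom g ∩ closure D ∧ zs ∈ subdifferential g l ∧
      zn ∈ normalCone (closure D) l := by
  rw [effDom_infConv hg h0 hbot hD hD0] at hz
  set S : Set (Vec k × ℝ) := {q | q.1 ∈ closure D ∧ g q.1 ≤ q.2}
  have hbdd := intrinsicInterior_subset hz
  obtain ⟨l, hlD, hl⟩ := exists_mem_epigraph_of_mem_intrinsicInterior (S := S)
    ((hD.closure.linear_preimage (LinearMap.fst ℝ (Vec k) ℝ)).inter hg)
    ((isClosed_closure.preimage continuous_fst).inter hcl)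
    ⟨0, subset_closure (interior_subset hD0), by simp [h0]⟩
    (fun q hq t ht => ⟨hq.1, hq.2.trans (by exact_mod_cast ht)⟩) hz
  set s := ⨆ q : S, (inner ℝ q.1.1 z - q.1.2)
  have hs : ∀ q ∈ S, inner ℝ q.1 z - q.2 ≤ s := fun q hq => le_ciSup hbdd ⟨q, hq⟩
  obtain ⟨z₁, z₂, a, b, hz, hab, ha, hb⟩ :=
    exists_split_of_zero_mem_interior hg (by simp [h0]) hD hD0
      fun q hq hqD => hs q ⟨subset_closure hqD, hq⟩
  simp only at hlD hl
  induction hgl : g l with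
  | bot => exact absurd hgl (hbot l)
  | top => exact absurd (hgl ▸ hl) (EReal.coe_lt_top _).not_ge
  | coe γ =>
    rw [hgl, EReal.coe_le_coe_iff] at hl
    -- Maximality gives `⟨l, z⟩ - γ ≥ s = a + b`, so both bounds `h1` and `h2` are equalities at
    -- `l`. Hence `l` maximizes each part separately: these are the subgradient and the normal cone
    -- conditions.
    have h1 := ha (l, γ) hgl.le
    have h2 := hb l hlD
    have h3 : inner ℝ l z = inner ℝ l z₁ + inner ℝ l z₂ := by rw [← hz, inner_add_right]
    simp only at h1
    refine ⟨z₁, z₂, l, hz.symm, ⟨show g l < ⊤ from hgl ▸ EReal.coe_lt_top γ, hlD⟩, fun y => ?_, fun y hy => ?_⟩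
    · induction hgy : g y with
      | bot => exact absurd hgy (hbot y)
      | top => exact le_top
      | coe η =>
        have h4 := ha (y, η) hgy.le
        rw [hgl, inner_sub_right, real_inner_comm y, real_inner_comm l]
        norm_cast
        simp only at h4
        linarith
    · have h4 := hb y hy
      rw [inner_sub_right, real_inner_comm y, real_inner_comm l]
      linarith

theorem infConv_eq_of_mem_subdifferential (hg : Convex ℝ {q : Vec k × ℝ | g q.1 ≤ q.2})
    (h0 : g 0 = 0) (hbot : ∀ l, g l ≠ ⊥) (hD : Convex ℝ D) (hD0 : 0 ∈ interior D)
    {zs zn l : Vec k}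
    (hl : l ∈ effDom g ∩ closure D) (hzs : zs ∈ subdifferential g l)
    (hzn : zn ∈ normalCone (closure D) l) :
    infConv (conjugate g) (supportFun D) (zs + zn) = conjugate g zs + supportFun D zn := by
  refine le_antisymm (iInf₂_le_of_le zs zn (iInf_le_of_le rfl le_rfl)) ?_
  obtain ⟨γ, hγ⟩ : ∃ γ : ℝ, g l = γ :=
    ⟨_, (EReal.coe_toReal (ne_of_lt hl.1) (hbot l)).symm⟩
  have h1 : conjugate g zs ≤ ((inner ℝ l zs - γ : ℝ) : EReal) := by
    rw [conjugate_le_coe_iff hbot]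
    rintro ⟨y, t⟩ hy
    have := (hzs y).trans hy
    rw [hγ, inner_sub_right, real_inner_comm y, real_inner_comm l] at this
    norm_cast at this
    simp only
    linarith
  have h2 : supportFun D zn ≤ ((inner ℝ l zn : ℝ) : EReal) := by
    rw [supportFun_le_coe_iff]
    intro y hy
    have := hzn y (subset_closure hy)
    rw [inner_sub_right, real_inner_comm y, real_inner_comm l] at this
    linarith
  -- The two bounds add up to `⟨l, zs + zn⟩ - g l`, which the rate function dominates even when `l`
  -- is only in `closure D`.
  refine (add_le_add h1 h2).trans (EReal.le_of_forall_lt_iff_le.1 fun s hs => ?_)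
  have := inner_sub_le_of_mem_closure hg h0 hD hD0
    ((infConv_le_coe_iff hg h0 hbot hD hD0).1 hs.le) (q := (l, γ)) hγ.le hl.2
  rw [inner_add_right] at this
  norm_cast
  simp only at this
  linarith

end Duality

/-! ### Additivity of the extended-real integral -/

section ExtIntegral

/-- The identity "positive part minus negative part" rearranged without subtraction, so that it
survives `q = ⊤` and can be integrated. -/
theorem toENNReal_coe_add_coe_add_ofReal_neg (q : ℝ≥0∞) (b : ℝ) :
    ((q : EReal) + b).toENNReal + ENNReal.ofReal (-b)
      = q + ENNReal.ofReal b + (-((q : EReal) + b)).toENNReal := by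
  induction q with
  | top => simp
  | coe q =>
    have h1 : ((q : ℝ≥0∞) : EReal) + b = ((q + b : ℝ) : EReal) := by
      rw [EReal.coe_add]; rfl
    rw [h1, ← EReal.coe_neg, EReal.real_coe_toENNReal, EReal.real_coe_toENNReal,
      ← ENNReal.ofReal_coe_nnreal]
    have hq : (0 : ℝ) ≤ q := q.coe_nonneg
    rcases le_total 0 b with hb | hb
    · rw [ENNReal.ofReal_of_nonpos (neg_nonpos.2 hb),
        ENNReal.ofReal_of_nonpos (p := -((q : ℝ) + b)) (neg_nonpos.2 (add_nonneg hq hb)),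
        ← ENNReal.ofReal_add hq hb]
    · rw [ENNReal.ofReal_of_nonpos hb]
      rcases le_total 0 ((q : ℝ) + b) with h | h
      · rw [ENNReal.ofReal_of_nonpos (neg_nonpos.2 h), add_zero, add_zero,
          ← ENNReal.ofReal_add h (neg_nonneg.2 hb), add_neg_cancel_right]
      · rw [ENNReal.ofReal_of_nonpos h, zero_add, add_zero,
          ← ENNReal.ofReal_add hq (neg_nonneg.2 h)]
        congr 1
        ring

theorem extIntegral_coe_add_coe {S : Type*} [MeasurableSpace S] {μ : Measure S} {q : S → ℝ≥0∞}
    (hq : Measurable q) {b : S → ℝ} (hbm : Measurable b) (hb : Integrable b μ) :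
    extIntegral μ (fun s => (q s : EReal) + (b s : EReal))
      = ((∫⁻ s, q s ∂μ : ℝ≥0∞) : EReal) + ((∫ s, b s ∂μ : ℝ) : EReal) := by
  have hG : Measurable fun s => (q s : EReal) + (b s : EReal) :=
    hq.coe_ereal_ennreal.add hbm.coe_real_ereal
  have hpos : ∫⁻ s, ENNReal.ofReal (b s) ∂μ ≠ ⊤ := hb.lintegral_lt_top.ne
  have hneg : ∫⁻ s, ENNReal.ofReal (-b s) ∂μ ≠ ⊤ := hb.neg.lintegral_lt_top.ne
  have hGneg : ∫⁻ s, (-((q s : EReal) + (b s : EReal))).toENNReal ∂μ ≠ ⊤ := by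
    refine ne_top_of_le_ne_top hneg (lintegral_mono fun s => ?_)
    rw [← EReal.real_coe_toENNReal, EReal.coe_neg]
    refine EReal.toENNReal_le_toENNReal (EReal.neg_le_neg_iff.2 ?_)
    exact le_add_of_nonneg_left (EReal.coe_ennreal_nonneg _)
  have hsum : ∫⁻ s, ((q s : EReal) + (b s : EReal)).toENNReal ∂μ + ∫⁻ s, ENNReal.ofReal (-b s) ∂μ
      = ∫⁻ s, q s ∂μ + ∫⁻ s, ENNReal.ofReal (b s) ∂μ
        + ∫⁻ s, (-((q s : EReal) + (b s : EReal))).toENNReal ∂μ := by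
    rw [← lintegral_add_left hG.ereal_toENNReal, ← lintegral_add_left hq,
      ← lintegral_add_left (f := fun s => q s + ENNReal.ofReal (b s)) (hq.add hbm.ennreal_ofReal)]
    exact lintegral_congr fun s => toENNReal_coe_add_coe_add_ofReal_neg _ _
  rw [extIntegral, integral_eq_lintegral_pos_part_sub_lintegral_neg_part hb]
  generalize ∫⁻ s, ((q s : EReal) + (b s : EReal)).toENNReal ∂μ = u at *
  generalize ∫⁻ s, (-((q s : EReal) + (b s : EReal))).toENNReal ∂μ = v at *
  generalize ∫⁻ s, ENNReal.ofReal (b s) ∂μ = p at *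
  generalize ∫⁻ s, ENNReal.ofReal (-b s) ∂μ = n at *
  generalize ∫⁻ s, q s ∂μ = w at *
  lift v to NNReal using hGneg
  lift p to NNReal using hpos
  lift n to NNReal using hneg
  induction w with
  | top =>
    have hu : u = ⊤ := by simpa using hsum
    subst hu
    rw [EReal.coe_ennreal_top, EReal.top_add_coe]
    exact EReal.top_sub_coe (v : ℝ)
  | coe w =>
    have hu : u ≠ ⊤ := fun h => by
      subst h
      rw [top_add] at hsum
      exact absurd hsum.symm (by finiteness)
    lift u to NNReal using hu
    have hsum' : (u : ℝ) + n = w + p + v := by exact_mod_cast hsum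
    change (((u : ℝ) : EReal) - ((v : ℝ) : EReal)) = ((w : ℝ) : EReal) + (((p : ℝ) - n : ℝ) : EReal)
    norm_cast
    linarith

end ExtIntegral

/-! ### Convexity, semicontinuity and centering of the log-Laplace transform -/

section Laplace

variable {Ω : Type*} [MeasurableSpace Ω] {P : Measure Ω} {k : ℕ} {Z : Ω → Vec k}

theorem measurable_ofReal_exp_inner (hZ : Measurable Z) (θ : Vec k) :
    Measurable fun ω => ENNReal.ofReal (Real.exp (inner ℝ θ (Z ω))) := by
  fun_prop

/-- Hölder's inequality with exponents `1 / a` and `1 / b`. -/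
theorem lintegral_exp_inner_convex_combo_le (hZ : Measurable Z) (θ θ' : Vec k) {a b : ℝ}
    (ha : 0 ≤ a) (hb : 0 ≤ b) (hab : a + b = 1) :
    ∫⁻ ω, ENNReal.ofReal (Real.exp (inner ℝ (a • θ + b • θ') (Z ω))) ∂P
      ≤ (∫⁻ ω, ENNReal.ofReal (Real.exp (inner ℝ θ (Z ω))) ∂P) ^ a
        * (∫⁻ ω, ENNReal.ofReal (Real.exp (inner ℝ θ' (Z ω))) ∂P) ^ b := by
  refine le_trans (le_of_eq (lintegral_congr fun ω => ?_))
    (ENNReal.lintegral_mul_norm_pow_le (measurable_ofReal_exp_inner hZ θ).aemeasurable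
      (measurable_ofReal_exp_inner hZ θ').aemeasurable ha hb hab)
  rw [ENNReal.ofReal_rpow_of_pos (Real.exp_pos _), ENNReal.ofReal_rpow_of_pos (Real.exp_pos _),
    ← ENNReal.ofReal_mul (by positivity), ← Real.exp_mul, ← Real.exp_mul, ← Real.exp_add,
    inner_add_left, real_inner_smul_left, real_inner_smul_left, mul_comm a, mul_comm b]

theorem logLaplace_convex_combo_le (hZ : Measurable Z) (θ θ' : Vec k) {a b : ℝ}
    (ha : 0 ≤ a) (hb : 0 ≤ b) (hab : a + b = 1) :
    logLaplace P Z (a • θ + b • θ') ≤ a * logLaplace P Z θ + b * logLaplace P Z θ' := by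
  rw [logLaplace, logLaplace, logLaplace, ← ENNReal.log_rpow, ← ENNReal.log_rpow,
    ← ENNReal.log_mul_add]
  exact ENNReal.log_le_log (lintegral_exp_inner_convex_combo_le hZ θ θ' ha hb hab)

theorem convex_laplaceDomain (hZ : Measurable Z) : Convex ℝ {θ | logLaplace P Z θ < ⊤} := by
  intro θ hθ θ' hθ' a b ha hb hab
  simp only [Set.mem_ofPred_eq, logLaplace, ENNReal.log_lt_top_iff] at *
  exact (lintegral_exp_inner_convex_combo_le hZ θ θ' ha hb hab).trans_lt
    (ENNReal.mul_lt_top (ENNReal.rpow_lt_top_of_nonneg ha hθ.ne)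
      (ENNReal.rpow_lt_top_of_nonneg hb hθ'.ne))

theorem lowerSemicontinuous_logLaplace (hZ : Measurable Z) :
    LowerSemicontinuous (logLaplace P Z) := by
  refine ENNReal.continuous_log.comp_lowerSemicontinuous ?_ ENNReal.log_monotone
  rw [lowerSemicontinuous_iff_le_liminf]
  intro θ
  -- Fatou's lemma along the filter `𝓝 θ`.
  refine le_trans (le_of_eq (lintegral_congr fun ω => ?_))
    (lintegral_liminf_le fun θ' => measurable_ofReal_exp_inner hZ θ')
  have hc : Continuous fun θ' : Vec k => ENNReal.ofReal (Real.exp (inner ℝ θ' (Z ω))) :=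
    ENNReal.continuous_ofReal.comp (by fun_prop)
  exact (hc.tendsto θ).liminf_eq.symm

theorem logLaplace_zero [IsProbabilityMeasure P] : logLaplace P Z 0 = 0 := by
  simp [logLaplace]

/-- Jensen's inequality in the form `1 + t ≤ exp t`, integrated against a centered variable. -/
theorem logLaplace_nonneg_of_integral_eq_zero [IsProbabilityMeasure P] (hZ : Measurable Z)
    (hint : Integrable Z P) (h0 : ∫ ω, Z ω ∂P = 0) (θ : Vec k) : 0 ≤ logLaplace P Z θ := by
  rw [logLaplace, ENNReal.zero_le_log_iff]
  by_cases htop : ∫⁻ ω, ENNReal.ofReal (Real.exp (inner ℝ θ (Z ω))) ∂P = ⊤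
  · simp [htop]
  have hexp : Integrable (fun ω => Real.exp (inner ℝ θ (Z ω))) P :=
    (lintegral_ofReal_ne_top_iff_integrable (by fun_prop)
      (ae_of_all _ fun ω => (Real.exp_pos _).le)).1 htop
  rw [← ofReal_integral_eq_lintegral_ofReal hexp (ae_of_all _ fun ω => (Real.exp_pos _).le),
    ← ENNReal.ofReal_one]
  refine ENNReal.ofReal_le_ofReal ?_
  have hi : Integrable (fun ω => inner ℝ θ (Z ω)) P := hint.const_inner θ
  calc (1 : ℝ) = ∫ ω, (inner ℝ θ (Z ω) + 1) ∂P := by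
        rw [integral_add hi (integrable_const _), integral_inner hint, h0]
        simp
    _ ≤ _ := integral_mono (hi.add (integrable_const _)) hexp fun ω => Real.add_one_le_exp _

theorem logLaplace_eq_sub_const (hZ : Measurable Z) (v θ : Vec k) :
    logLaplace P Z θ = logLaplace P (fun ω => Z ω - v) θ + ((inner ℝ θ v : ℝ) : EReal) := by
  rw [logLaplace, logLaplace, ← Real.log_exp (inner ℝ θ v),
    ← ENNReal.log_ofReal_of_pos (Real.exp_pos _), ← ENNReal.log_mul_add,
    ← lintegral_mul_const _ (measurable_ofReal_exp_inner (hZ.sub_const v) θ)]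
  congr 1
  refine lintegral_congr fun ω => ?_
  rw [← ENNReal.ofReal_mul (Real.exp_pos _).le, ← Real.exp_add, inner_sub_right, sub_add_cancel]

theorem integrable_of_integrable_exp_norm (hZ : Measurable Z) {α : ℝ} (hα : 0 < α)
    (h : Integrable (fun ω => Real.exp (α * ‖Z ω‖)) P) : Integrable Z P := by
  refine (h.const_mul α⁻¹).mono' hZ.aestronglyMeasurable (ae_of_all _ fun ω => ?_)
  have h1 := Real.add_one_le_exp (α * ‖Z ω‖)
  rw [← mul_le_mul_iff_right₀ hα, ← mul_assoc, mul_inv_cancel₀ hα.ne', one_mul]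
  linarith

end Laplace

/-! ### The common domain is a convex neighbourhood of the origin -/

section Domain

variable {Ω : Type*} [MeasurableSpace Ω] {P : Measure Ω} {d m : ℕ} {Z : Ω → Vec d}

theorem continuous_matVec :
    Continuous fun p : Matrix (Fin m) (Fin d) ℝ × Vec d => matVec p.1 p.2 :=
  (PiLp.continuous_toLp 2 _).comp
    (continuous_fst.matrix_mulVec ((PiLp.continuous_ofLp 2 _).comp continuous_snd))

theorem matVec_smul (y : Matrix (Fin m) (Fin d) ℝ) (c : ℝ) (v : Vec d) :
    matVec y (c • v) = c • matVec y v := by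
  simp [matVec, Matrix.mulVec_smul]

theorem exists_norm_matVec_le {K : Set (Matrix (Fin m) (Fin d) ℝ)} (hK : IsCompact K) :
    ∃ M : ℝ, 0 < M ∧ ∀ y ∈ K, ∀ v : Vec d, ‖matVec y v‖ ≤ M * ‖v‖ := by
  obtain ⟨M, hM⟩ := (hK.prod (isCompact_closedBall (0 : Vec d) 1)).exists_bound_of_continuousOn
    continuous_matVec.continuousOn
  refine ⟨max M 1, by positivity, fun y hy v => ?_⟩
  rcases eq_or_ne v 0 with rfl | hv
  · have := matVec_smul y 0 0
    simp only [zero_smul] at this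
    simp [this]
  · have hv' : 0 < ‖v‖ := norm_pos_iff.2 hv
    have h1 := hM (y, ‖v‖⁻¹ • v) ⟨hy, by simp [norm_smul, hv'.ne']⟩
    rw [matVec_smul, norm_smul, norm_inv, norm_norm] at h1
    calc ‖matVec y v‖ = ‖v‖⁻¹ * ‖matVec y v‖ * ‖v‖ := by field_simp
      _ ≤ max M 1 * ‖v‖ := by gcongr; exact h1.trans (le_max_left _ _)

theorem measurable_matVec (hZ : Measurable Z) (y : Matrix (Fin m) (Fin d) ℝ) :
    Measurable fun ω => matVec y (Z ω) :=
  (continuous_matVec.comp (Continuous.prodMk_right y)).measurable.comp hZ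

theorem convex_commonDomain (hZ : Measurable Z) (A : Set (Matrix (Fin m) (Fin d) ℝ)) :
    Convex ℝ (commonDomain P Z A) :=
  convex_iInter₂ fun y _ => convex_laplaceDomain (measurable_matVec hZ y)

/-- A bound `M` on the operator norms over `K` works for all matrices at once: if `‖l‖ < α / M`,
then `⟨l, y · Z⟩ ≤ α ‖Z‖`. -/
theorem zero_mem_interior_commonDomain {α : ℝ} (hα : 0 < α)
    (hexp : Integrable (fun ω => Real.exp (α * ‖Z ω‖)) P)
    {A K : Set (Matrix (Fin m) (Fin d) ℝ)} (hK : IsCompact K) (hA : A ⊆ K) :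
    0 ∈ interior (commonDomain P Z A) := by
  obtain ⟨M, hM0, hM⟩ := exists_norm_matVec_le hK
  rw [mem_interior_iff_mem_nhds]
  filter_upwards [Metric.ball_mem_nhds (0 : Vec m) (div_pos hα hM0)] with l hl
  rw [mem_ball_zero_iff, lt_div_iff₀ hM0] at hl
  refine Set.mem_iInter₂.2 fun y hy => ?_
  change ENNReal.log _ < ⊤
  rw [ENNReal.log_lt_top_iff]
  refine lt_of_le_of_lt (lintegral_mono fun ω => ?_) hexp.lintegral_lt_top
  refine ENNReal.ofReal_le_ofReal (Real.exp_le_exp.2 ((real_inner_le_norm _ _).trans ?_))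
  calc ‖l‖ * ‖matVec y (Z ω)‖ ≤ ‖l‖ * (M * ‖Z ω‖) := by gcongr; exact hM y (hA hy) _
    _ = ‖l‖ * M * ‖Z ω‖ := by ring
    _ ≤ α * ‖Z ω‖ := by gcongr

theorem innerLimit_subset {S : Type*} [TopologicalSpace S] {C : ℕ → Set S} {K : Set S}
    (hK : IsClosed K) (h : ∀ n, 1 ≤ n → C n ⊆ K) : innerLimit C ⊆ K := by
  rintro s ⟨n₀, u, hu, hlim⟩
  refine hK.mem_of_tendsto hlim ?_
  filter_upwards [eventually_ge_atTop n₀, eventually_ge_atTop 1] with n h0 h1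
  exact h n h1 (hu n h0)

end Domain

/-! ### Convexity and closedness of the epigraph of `Γ` -/

section Gamma

theorem convex_epigraph_of_ennreal {E : Type*} [AddCommGroup E] [Module ℝ E] {Q : E → ℝ≥0∞}
    (hQ : ∀ x y : E, ∀ a b : ℝ, 0 ≤ a → 0 ≤ b → a + b = 1 →
      Q (a • x + b • y) ≤ ENNReal.ofReal a * Q x + ENNReal.ofReal b * Q y) (β : E →ₗ[ℝ] ℝ) :
    Convex ℝ {q : E × ℝ | (Q q.1 : EReal) + (β q.1 : EReal) ≤ q.2} := by
  -- With the linear form moved to the right, only nonnegative quantities remain to be compared.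
  have key : ∀ q : E × ℝ, (Q q.1 : EReal) + (β q.1 : EReal) ≤ q.2 ↔
      0 ≤ q.2 - β q.1 ∧ Q q.1 ≤ ENNReal.ofReal (q.2 - β q.1) := fun q => by
    rw [← EReal.le_sub_iff_add_le (by simp) (by simp), ← EReal.coe_sub]
    constructor
    · intro h
      have h0 : 0 ≤ q.2 - β q.1 := by exact_mod_cast (EReal.coe_ennreal_nonneg _).trans h
      refine ⟨h0, ?_⟩
      rwa [← EReal.coe_ennreal_le_coe_ennreal_iff, EReal.coe_ennreal_ofReal, max_eq_left h0]
    · rintro ⟨h0, h⟩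
      rwa [← EReal.coe_ennreal_le_coe_ennreal_iff, EReal.coe_ennreal_ofReal, max_eq_left h0] at h
  intro q hq q' hq' a b ha hb hab
  rw [Set.mem_ofPred_eq, key] at *
  have heq : (a • q + b • q').2 - β (a • q + b • q').1
      = a * (q.2 - β q.1) + b * (q'.2 - β q'.1) := by
    simp only [Prod.snd_add, Prod.smul_snd, Prod.fst_add, Prod.smul_fst, smul_eq_mul, map_add,
      map_smul]
    ring
  have h1 := mul_nonneg ha hq.1
  have h2 := mul_nonneg hb hq'.1
  rw [heq]
  refine ⟨add_nonneg h1 h2, (hQ _ _ a b ha hb hab).trans ?_⟩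
  rw [ENNReal.ofReal_add h1 h2, ENNReal.ofReal_mul ha, ENNReal.ofReal_mul hb]
  gcongr
  exacts [hq.2, hq'.2]

theorem isClosed_epigraph_of_ennreal {E : Type*} [TopologicalSpace E] {Q : E → ℝ≥0∞}
    (hQ : LowerSemicontinuous Q) {β : E → ℝ} (hβ : Continuous β) :
    IsClosed {q : E × ℝ | (Q q.1 : EReal) + (β q.1 : EReal) ≤ q.2} := by
  have h1 : LowerSemicontinuous fun x => (Q x : EReal) :=
    continuous_coe_ennreal_ereal.comp_lowerSemicontinuous hQ
      fun _ _ h => EReal.coe_ennreal_le_coe_ennreal_iff.2 h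
  have h2 : Continuous fun q : E × ℝ => (q.1, ((q.2 - β q.1 : ℝ) : EReal)) :=
    continuous_fst.prodMk (continuous_coe_real_ereal.comp (by fun_prop))
  convert h1.isClosed_epigraph.preimage h2 using 1
  ext q
  simp only [Set.mem_ofPred_eq, Set.mem_preimage, EReal.coe_sub]
  rw [EReal.le_sub_iff_add_le (by simp) (by simp)]

variable {d m : ℕ}

/-- The vector `∑ k, l_k f_k`, for the rows `f_k` of a matrix. -/
def rowCombo (y : Matrix (Fin m) (Fin d) ℝ) (l : Vec m) : Vec d :=
  ∑ k : Fin m, l k • (WithLp.toLp 2 (y k) : Vec d)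

theorem continuous_rowCombo_left {X : Type*} [TopologicalSpace X]
    {f : X → Matrix (Fin m) (Fin d) ℝ} (hf : Continuous f) (l : Vec m) :
    Continuous fun x => rowCombo (f x) l :=
  continuous_finsetSum _ fun k _ => ((PiLp.continuous_toLp 2 _).comp
    ((continuous_apply k).comp hf)).const_smul (l k)

theorem continuous_rowCombo_right (y : Matrix (Fin m) (Fin d) ℝ) : Continuous (rowCombo y) := by
  unfold rowCombo
  fun_prop

theorem rowCombo_convex_combo (y : Matrix (Fin m) (Fin d) ℝ) (l l' : Vec m) (a b : ℝ) :
    rowCombo y (a • l + b • l') = a • rowCombo y l + b • rowCombo y l' := by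
  simp only [rowCombo, Finset.smul_sum, ← Finset.sum_add_distrib, smul_smul, ← add_smul]
  rfl

theorem gammaFun_zero {Ω : Type*} [MeasurableSpace Ω] {P : Measure Ω} [IsProbabilityMeasure P]
    {X : Type*} [MeasurableSpace X] {R : Measure X} {Z : Ω → Vec d}
    {f : X → Matrix (Fin m) (Fin d) ℝ} : gammaFun P Z R f 0 = 0 := by
  simp [gammaFun, logLaplace_zero, extIntegral]

variable {Ω : Type*} [MeasurableSpace Ω] {P : Measure Ω} [IsProbabilityMeasure P]
  {X : Type*} [MetricSpace X] [MeasurableSpace X] [BorelSpace X] {R : Measure X}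
  [IsProbabilityMeasure R] {Z : Ω → Vec d} {f : X → Matrix (Fin m) (Fin d) ℝ}

theorem integrable_inner_rowCombo (hRcompact : IsCompact R.support) (hRnull : R R.supportᶜ = 0)
    (hf : Continuous f) (v : Vec d) (l : Vec m) :
    Integrable (fun x => inner ℝ (rowCombo (f x) l) v) R := by
  have hc : Continuous fun x => inner ℝ (rowCombo (f x) l) v :=
    (continuous_rowCombo_left hf l).inner continuous_const
  have := hc.continuousOn.integrableOn_compact (μ := R) hRcompact
  rwa [IntegrableOn, Measure.restrict_eq_self_of_ae_mem (measure_eq_zero_iff_ae_notMem.1 hRnull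
    |>.mono fun x hx => not_not.1 hx)] at this

/-- `Γ` is the sum of a convex, lower semicontinuous, nonnegative function and of a linear form. -/
theorem exists_gammaFun_eq (hZ : Measurable Z) (hint : Integrable Z P)
    (hRcompact : IsCompact R.support) (hRnull : R R.supportᶜ = 0) (hf : Continuous f) :
    ∃ (Q : Vec m → ℝ≥0∞) (β : Vec m →ₗ[ℝ] ℝ),
      (∀ x y, ∀ a b : ℝ, 0 ≤ a → 0 ≤ b → a + b = 1 →
        Q (a • x + b • y) ≤ ENNReal.ofReal a * Q x + ENNReal.ofReal b * Q y) ∧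
      LowerSemicontinuous Q ∧ ∀ l, gammaFun P Z R f l = (Q l : EReal) + (β l : EReal) := by
  -- Centering makes the log-Laplace transform nonnegative, so Tonelli-type additivity and Fatou's
  -- lemma apply to its integral; the mean contributes only a linear form.
  set v := ∫ ω, Z ω ∂P with hv
  have hZc : Measurable fun ω => Z ω - v := hZ.sub_const v
  have hnonneg : ∀ θ, 0 ≤ logLaplace P (fun ω => Z ω - v) θ :=
    logLaplace_nonneg_of_integral_eq_zero hZc (hint.sub (integrable_const v))
      (by rw [integral_sub hint (integrable_const v)]; simp [hv])
  set q : Vec d → ℝ≥0∞ := fun θ => (logLaplace P (fun ω => Z ω - v) θ).toENNReal with hq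
  have hqlsc : LowerSemicontinuous q :=
    EReal.continuous_toENNReal.comp_lowerSemicontinuous (lowerSemicontinuous_logLaplace hZc)
      fun _ _ h => EReal.toENNReal_le_toENNReal h
  have hqm : ∀ l : Vec m, Measurable fun x => q (rowCombo (f x) l) := fun l =>
    hqlsc.measurable.comp (continuous_rowCombo_left hf l).measurable
  have hqconv : ∀ θ θ' : Vec d, ∀ a b : ℝ, 0 ≤ a → 0 ≤ b → a + b = 1 →
      q (a • θ + b • θ') ≤ ENNReal.ofReal a * q θ + ENNReal.ofReal b * q θ' := by
    intro θ θ' a b ha hb hab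
    refine (EReal.toENNReal_le_toENNReal
      (logLaplace_convex_combo_le hZc θ θ' ha hb hab)).trans (EReal.toENNReal_add_le.trans ?_)
    rw [EReal.toENNReal_mul (by exact_mod_cast ha), EReal.toENNReal_mul (by exact_mod_cast hb),
      EReal.real_coe_toENNReal, EReal.real_coe_toENNReal]
  have hb := integrable_inner_rowCombo hRcompact hRnull hf v
  have hblin : ∀ (x : X) (l l' : Vec m) (a b : ℝ), inner ℝ (rowCombo (f x) (a • l + b • l')) v
      = a * inner ℝ (rowCombo (f x) l) v + b * inner ℝ (rowCombo (f x) l') v := fun x l l' a b => by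
    rw [rowCombo_convex_combo, inner_add_left, real_inner_smul_left, real_inner_smul_left]
  refine ⟨fun l => ∫⁻ x, q (rowCombo (f x) l) ∂ R,
    { toFun := fun l => ∫ x, inner ℝ (rowCombo (f x) l) v ∂ R
      map_add' := fun l l' => ?_
      map_smul' := fun a l => ?_ }, fun l l' a b ha hb' hab => ?_, ?_, fun l => ?_⟩
  · rw [← integral_add (hb l) (hb l')]
    refine integral_congr_ae (ae_of_all _ fun x => ?_)
    simpa using hblin x l l' 1 1
  · rw [RingHom.id_apply, smul_eq_mul, ← integral_const_mul]
    refine integral_congr_ae (ae_of_all _ fun x => ?_)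
    simpa using hblin x l 0 a 0
  · rw [← lintegral_const_mul _ (hqm l), ← lintegral_const_mul _ (hqm l'),
      ← lintegral_add_left ((hqm l).const_mul _)]
    refine lintegral_mono fun x => ?_
    rw [rowCombo_convex_combo]
    exact hqconv _ _ a b ha hb' hab
  · rw [lowerSemicontinuous_iff_le_liminf]
    intro l
    refine le_trans (lintegral_mono fun x => ?_) (lintegral_liminf_le hqm)
    exact lowerSemicontinuous_iff_le_liminf.1
      (hqlsc.comp (continuous_rowCombo_right (f x))) l
  · refine Eq.trans ?_ (extIntegral_coe_add_coe (hqm l)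
      ((continuous_rowCombo_left hf l).inner continuous_const).measurable (hb l))
    refine congrArg (extIntegral R) (funext fun x => ?_)
    rw [hq, EReal.coe_toENNReal (hnonneg _)]
    exact logLaplace_eq_sub_const hZ v _

end Gamma

end WeightedMeanLDP

end

theorem theorem3p5
    {Ω : Type*} [MeasurableSpace Ω] (P : Measure Ω) [IsProbabilityMeasure P]
    {X : Type*} [MetricSpace X] [LocallyCompactSpace X] [MeasurableSpace X] [BorelSpace X]
    (d m : ℕ)
    -- an i.i.d. sequence of random vectors; `Z 0` is the first of them
    (Z : ℕ → Ω → Vec d) (hZmeas : ∀ i, Measurable (Z i))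
    (hZindep : iIndepFun Z P) (hZident : ∀ i, IdentDistrib (Z i) (Z 0) P P)
    -- an exponential moment, and the LDP for `Z 0 / n` with good rate function `I`
    (hZexp : ∃ α : ℝ, 0 < α ∧ Integrable (fun ω => Real.exp (α * ‖Z 0 ω‖)) P)
    (I : Vec d → EReal) (hI : IsGoodRateFunction I)
    (hIldp : SatisfiesLDP (fun n : ℕ => P.map (fun ω => (n : ℝ)⁻¹ • Z 0 ω)) I)
    -- the convex case
    (hIconv : ∀ z, I z = supportFun (laplaceDomain P (Z 0)) z)
    -- the triangular array, its limiting measure `R` with compact support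
    (x : (n : ℕ) → Fin n → X) (R : Measure X) [IsProbabilityMeasure R]
    (hxR : ConvergesWeakly (fun n => empiricalMeasure Finset.univ (x n)) R)
    (hRcompact : IsCompact R.support) (hRnull : R R.supportᶜ = 0)
    (hRpos : ∀ U : Set X, IsOpen U → (U ∩ R.support).Nonempty → 0 < R (U ∩ R.support))
    -- the splitting of the indices: `B n` (bulk), its complement (outliers)
    (B : (n : ℕ) → Finset (Fin n))
    (hBcard : Tendsto (fun n : ℕ => ((B n).card : ℝ) / (n : ℝ)) atTop (𝓝 1))
    (hBweak : ConvergesWeakly (fun n => empiricalMeasure (B n) (x n)) R)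
    (hBdist : ∀ ε : ℝ, 0 < ε → ∀ᶠ n in atTop, ∀ i ∈ B n,
      Metric.infDist (x n i) R.support < ε)
    -- the matrix weights
    (f : X → Matrix (Fin m) (Fin d) ℝ) (hf : Continuous f)
    (hCne : ∀ n : ℕ, 1 ≤ n → (outlierMatrices f (x n) (B n)).Nonempty)
    (hCcompact : ∃ K : Set (Matrix (Fin m) (Fin d) ℝ), IsCompact K ∧
      ∀ n : ℕ, 1 ≤ n → outlierMatrices f (x n) (B n) ⊆ K)
    -- the common domain of the inner and of the outer limit of the outlier matrices
    (D : Set (Vec m))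
    (hDin : D = commonDomain P (Z 0) (innerLimit fun n => outlierMatrices f (x n) (B n)))
    (hDout : D = commonDomain P (Z 0) (outerLimit fun n => outlierMatrices f (x n) (B n))) :
    (∀ z : Vec m, rateFun P (Z 0) R f D z
        = ⨆ l ∈ D, ((inner ℝ l z : ℝ) : EReal) - gammaFun P (Z 0) R f l) ∧
    (∀ z ∈ intrinsicInterior ℝ (effDom (rateFun P (Z 0) R f D)),
      (∃ zs zn l : Vec m, z = zs + zn ∧
        l ∈ effDom (gammaFun P (Z 0) R f) ∩ closure D ∧
        zs ∈ subdifferential (gammaFun P (Z 0) R f) l ∧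
        zn ∈ normalCone (closure D) l) ∧
      (∀ zs zn l : Vec m, z = zs + zn →
        l ∈ effDom (gammaFun P (Z 0) R f) ∩ closure D →
        zs ∈ subdifferential (gammaFun P (Z 0) R f) l →
        zn ∈ normalCone (closure D) l →
        rateFun P (Z 0) R f D z
          = conjugate (gammaFun P (Z 0) R f) zs + supportFun D zn)) := by
  obtain ⟨α, hα, hexp⟩ := hZexp
  obtain ⟨K, hK, hCK⟩ := hCcompact
  have hD : Convex ℝ D := hDin ▸ convex_commonDomain (hZmeas 0) _
  have hD0 : 0 ∈ interior D :=
    hDin ▸ zero_mem_interior_commonDomain hα hexp hK (innerLimit_subset hK.isClosed hCK)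
  obtain ⟨Q, β, hQconv, hQlsc, hΓ⟩ := exists_gammaFun_eq (hZmeas 0)
    (integrable_of_integrable_exp_norm (hZmeas 0) hα hexp) hRcompact hRnull hf
  have h0 : gammaFun P (Z 0) R f 0 = 0 := gammaFun_zero
  have hbot : ∀ l, gammaFun P (Z 0) R f l ≠ ⊥ := fun l => by
    rw [hΓ]
    exact EReal.add_ne_bot_iff.2 ⟨EReal.coe_ennreal_ne_bot _, EReal.coe_ne_bot _⟩
  have hconv : Convex ℝ {q : Vec m × ℝ | gammaFun P (Z 0) R f q.1 ≤ q.2} := by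
    simp only [hΓ]
    exact convex_epigraph_of_ennreal hQconv β
  have hclosed : IsClosed {q : Vec m × ℝ | gammaFun P (Z 0) R f q.1 ≤ q.2} := by
    simp only [hΓ]
    exact isClosed_epigraph_of_ennreal hQlsc β.continuous_of_finiteDimensional
  refine ⟨infConv_conjugate_supportFun hconv h0 hbot hD hD0, fun z hz =>
    ⟨exists_subdifferential_add_normalCone hconv hclosed h0 hbot hD hD0 hz, ?_⟩⟩
  rintro zs zn l rfl hl hzs hzn
  exact infConv_eq_of_mem_subdifferential hconv h0 hbot hD hD0 hl hzs hzn
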